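/- **Theorem 1.** Let $d\in\{2,3\}$, let $y_1,\dots,y_n\in\mathbb R^d$ ($n\ge 0$) be distinct points and let $\alpha_1,\dots,\alpha_n\in\mathbb R\cup\{\infty\}$. Let $v=\sum_j\varepsilon_j\delta(x-y_j)$ be the multipoint scatterer of Bethe–Peierls–Fermi–Zeldovich–Berezin–Faddeev type with parameters $\alpha_j$: solutions $\psi$ of $-\Delta\psi+v\psi=E\psi$ satisfy, for each $j$, $\psi(x)=\psi_{j,-1}\,\sigma(|x-y_j|)+\psi_{j,0}+O(|x-y_j|)$ as $x\to y_j$, where, for finite $\alpha_j$, $\sigma(r)=\ln r$ and $(-2\pi\alpha_j-\ln 2+\gamma)\psi_{j,-1}=\psi_{j,0}$ if $d=2$ ($\gamma$ is Euler's constant), $\sigma(r)=1/r$ and $4\pi\alpha_j\psi_{j,-1}=\psi_{j,0}$ if $d=3$, while $\psi_{j,-1}=0$ if $\alpha_j=\infty$. Let $G^+(x,\kappa^2)=-\frac i4H^1_0(\kappa|x|)$ for $d=2$ ($H^1_0$ is the Hankel function of the first kind) and $G^+(x,\kappa^2)=-\frac{e^{i\kappa|x|}}{4\pi|x|}$ for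 $d=3$. For $E>0$ and $k,l\in\mathbb R^d$ with $k^2=l^2=E$, let $$\psi^+(x,k)=e^{ikx}+\sum_{j=1}^n q_j(k)\,G^+(x-y_j,E)$$ be the scattering eigenfunction, where $q(k)\in\mathbb C^n$ is such that $\psi^+(\cdot,k)$ satisfies the above conditions at all the points $y_j$, let $$f(k,l)=\frac1{(2\pi)^d}\sum_{j=1}^n q_j(k)\,e^{-ily_j}$$ be the scattering amplitude, and let $\hat S_E$ be the scattering operator on $L^2(\mathbb S^{d-1})$, $$(\hat S_Eu)(\theta)=u(\theta)-i\pi E^{(d-2)/2}\int_{\mathbb S^{d-1}}f(\sqrt E\,\theta',\sqrt E\,\theta)\,u(\theta')\,d\theta'.$$ Then for every $E>0$ the operator $\hat S_E$ is well defined (it exists, as a bounded operator, and is unique), and $E$ is a transmission eigenvalue of infinite multiplicity in the strong sense: $1$ is an eigenvalue of $\hat S_E$ and the space of $u\in L^2(\mathbb S^{d-1})$ with $\hat S_Eu=u$ is infinite-dimensional. -/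

import Mathlib

open MeasureTheory Topology
open scoped Nat

noncomputable section

/-- The Bessel function of the first kind of order `0`, by its power series. -/
def besselJZero (x : ℝ) : ℝ :=
  ∑' m : ℕ, (-1 : ℝ) ^ m / (m ! : ℝ) ^ 2 * (x / 2) ^ (2 * m)

/-- The Bessel function of the second kind (Neumann function) of order `0`, for `x > 0`, by its
standard series; `harmonic m = 1 + 1/2 + ⋯ + 1/m`. -/
def besselYZero (x : ℝ) : ℝ :=
  2 / Real.pi * ((Real.log (x / 2) + Real.eulerMascheroniConstant) * besselJZero x
    - ∑' m : ℕ, (-1 : ℝ) ^ m * (harmonic m : ℝ) / (m ! : ℝ) ^ 2 * (x / 2) ^ (2 * m))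

/-- The Hankel function of the first kind of order `0`, for `x > 0`. -/
def hankelOneZero (x : ℝ) : ℂ :=
  (besselJZero x : ℂ) + Complex.I * (besselYZero x : ℂ)

/-- The outgoing Green function `G⁺` of `Δ + κ²` in dimension `d = 2` or `d = 3`, as a function of
the distance `r > 0` to its singularity. -/
def outgoingGreen (d : ℕ) (κ r : ℝ) : ℂ :=
  if d = 2 then -(Complex.I / 4) * hankelOneZero (κ * r)
  else -Complex.exp (Complex.I * ((κ * r : ℝ) : ℂ)) / ((4 * Real.pi * r : ℝ) : ℂ)

/-- The singular term at a point scatterer: `ln r` for `d = 2` and `1 / r` for `d = 3`. -/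
def pointSingularity (d : ℕ) (r : ℝ) : ℝ :=
  if d = 2 then Real.log r else 1 / r

/-- The ratio of the regular to the singular coefficient prescribed by the strength parameter
`a`: `-2πa - ln 2 + γ` for `d = 2` and `4πa` for `d = 3`. -/
def pointRatio (d : ℕ) (a : ℝ) : ℝ :=
  if d = 2 then -2 * Real.pi * a - Real.log 2 + Real.eulerMascheroniConstant
  else 4 * Real.pi * a

/-- The Bethe–Peierls condition at `y` with parameter `α ∈ ℝ ∪ {∞}`:
`ψ(x) = s · (ln |x - y| or 1 / |x - y|) + c + O(|x - y|)` as `x → y`, where `c` is the prescribed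
multiple of `s`; for `α = ∞` the scatterer is absent, that is, `s = 0`. -/
def PointCondition {d : ℕ} (α : OnePoint ℝ) (y : EuclideanSpace ℝ (Fin d))
    (ψ : EuclideanSpace ℝ (Fin d) → ℂ) : Prop :=
  ∃ s c : ℂ,
    ((fun x => ψ x - (s * (pointSingularity d ‖x - y‖ : ℂ) + c)) =O[𝓝[≠] y] fun x => ‖x - y‖) ∧
    (α = OnePoint.infty → s = 0) ∧
    ∀ a : ℝ, α = (a : OnePoint ℝ) → (pointRatio d a : ℂ) * s = c

/-- A multipoint scatterer `∑ⱼ εⱼ δ(x - yⱼ)` in `ℝᵈ`: distinct points with the parameters `αⱼ` that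
encode the strengths `εⱼ`. -/
structure MultipointScatterer (d n : ℕ) where
  y : Fin n → EuclideanSpace ℝ (Fin d)
  y_injective : Function.Injective y
  α : Fin n → OnePoint ℝ

/-- The unit sphere of `ℝᵈ`. -/
abbrev UnitSphere (d : ℕ) : Type := Metric.sphere (0 : EuclideanSpace ℝ (Fin d)) 1

/-- The standard surface measure of the unit sphere of `ℝᵈ`. -/
def sphereMeasure (d : ℕ) : Measure (UnitSphere d) :=
  (volume : Measure (EuclideanSpace ℝ (Fin d))).toSphere

namespace MultipointScatterer

variable {d n : ℕ}

/-- The plane wave `e^{ikx}` plus outgoing waves of amplitudes `qⱼ` emitted from the points `yⱼ`. -/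
def wave (v : MultipointScatterer d n) (k : EuclideanSpace ℝ (Fin d)) (q : Fin n → ℂ)
    (x : EuclideanSpace ℝ (Fin d)) : ℂ :=
  Complex.exp (Complex.I * ((inner ℝ k x : ℝ) : ℂ))
    + ∑ j, q j * outgoingGreen d ‖k‖ ‖x - v.y j‖

/-- `q` is the vector of amplitudes of the scattering eigenfunction `ψ⁺(·, k)`: the corresponding
wave satisfies the point conditions at all the scatterers. -/
def IsScatteringVector (v : MultipointScatterer d n) (k : EuclideanSpace ℝ (Fin d))
    (q : Fin n → ℂ) : Prop :=
  ∀ j, PointCondition (v.α j) (v.y j) (v.wave k q)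

/-- `f` is the (normalized) scattering amplitude of `v` at the energy `E`, that is, for
`|k|² = |l|² = E`; its values elsewhere play no role. -/
def IsScatteringAmplitude (v : MultipointScatterer d n) (E : ℝ)
    (f : EuclideanSpace ℝ (Fin d) → EuclideanSpace ℝ (Fin d) → ℂ) : Prop :=
  ∀ k : EuclideanSpace ℝ (Fin d), ‖k‖ ^ 2 = E →
    ∃ q : Fin n → ℂ, v.IsScatteringVector k q ∧
      ∀ l : EuclideanSpace ℝ (Fin d), ‖l‖ ^ 2 = E →
        f k l = 1 / (2 * (Real.pi : ℂ)) ^ d *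
          ∑ j, q j * Complex.exp (-(Complex.I * ((inner ℝ l (v.y j) : ℝ) : ℂ)))

/-- `S` is the scattering operator of `v` on `L²(Sᵈ⁻¹)` at the energy `E = |k|²`:
`(S u)(θ) = u(θ) - iπ |k|^{d-2} ∫ f(|k|θ', |k|θ) u(θ') dθ'`. -/
def IsScatteringOperator (v : MultipointScatterer d n) (E : ℝ)
    (S : Lp ℂ 2 (sphereMeasure d) →L[ℂ] Lp ℂ 2 (sphereMeasure d)) : Prop :=
  ∃ f, v.IsScatteringAmplitude E f ∧ ∀ u : Lp ℂ 2 (sphereMeasure d),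
    (∀ θ : UnitSphere d, Integrable (fun θ' : UnitSphere d =>
      f (√E • (θ' : EuclideanSpace ℝ (Fin d))) (√E • (θ : EuclideanSpace ℝ (Fin d))) * u θ')
      (sphereMeasure d)) ∧
    ∀ᵐ θ ∂(sphereMeasure d), S u θ = u θ - Complex.I * (Real.pi : ℂ) * ((√E : ℝ) : ℂ) ^ (d - 2) *
      ∫ θ' : UnitSphere d,
        f (√E • (θ' : EuclideanSpace ℝ (Fin d))) (√E • (θ : EuclideanSpace ℝ (Fin d))) * u θ'
        ∂(sphereMeasure d)

end MultipointScatterer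

end

/-!
For a wave `e^{ikx} + ∑ₘ qₘ G⁺(x - yₘ)` with `|k| = κ`, the expansion `G⁺ = g σ(r) + h + O(r)` of
the Green function at its singularity turns the point condition at `yⱼ` into a linear equation for
`q` (`pointCondition_wave_iff`). For finite `αⱼ` it has a real diagonal coefficient minus row `j`
of the symmetric matrix `M` with entries `G⁺(yⱼ - yₘ)` off the diagonal and `h` on it; for `αⱼ =
∞` it is `qⱼ = 0`.

The system is uniquely solvable (`isUnit_systemMatrix`), because the imaginary part of `M` is
negative definite. Indeed `Im G⁺` is a negative multiple of the Fourier transform of the surface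
measure of the sphere: `J₀` for `d = 2` and `sinc` for `d = 3` (`exists_im_green_eq_inner`), which
is computed from the moments `∫ ⟪θ, z⟫ ^ (2m)`; these come from evaluating a Gaussian integral
both in polar and in Cartesian coordinates. Hence `Im ⟨q, M q⟩ = -w ‖∑ qⱼ e_{κ yⱼ}‖²` in `L²` of
the sphere, where `e_z` is the plane wave `θ ↦ e^{iθ·z}`, and for a solution of the homogeneous
system this vanishes. Plane waves with distinct `z` are linearly independent on the sphere
(`linearIndependent_planeWave`): on a great circle they continue analytically to complex angles,
where they grow at different rates.

Therefore the amplitudes are fixed linear combinations of the numbers `e^{ik·yₘ}`, and the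
scattering operator is the identity plus an explicit operator of finite rank. Since `L²` of the
sphere is infinite-dimensional (again by the independence of plane waves), the kernel of that
finite-rank operator, which is the space of fixed vectors of the scattering operator, is infinite-
dimensional.
-/

open MeasureTheory Topology
open scoped Nat

noncomputable section

/-! ### Moments of the surface measure of the sphere -/

/-- Integration in polar coordinates of the product of a function homogeneous of degree `p` and a
radial function. -/
theorem integral_homogeneous_mul_radial {V : Type*} [NormedAddCommGroup V] [NormedSpace ℝ V]
    [Nontrivial V] [FiniteDimensional ℝ V] [MeasurableSpace V] [BorelSpace V]
    (μ : Measure V) [μ.IsAddHaarMeasure] (p : ℕ) (g : V → ℝ)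
    (hg : ∀ (r : ℝ) (x : V), 0 < r → g (r • x) = r ^ p * g x) (h : ℝ → ℝ) :
    ∫ x, g x * h ‖x‖ ∂μ = (∫ θ : Metric.sphere (0 : V) 1, g θ ∂μ.toSphere) *
      ∫ r in Set.Ioi (0 : ℝ), r ^ (Module.finrank ℝ V - 1) * (r ^ p * h r) := by
  set N := Module.finrank ℝ V - 1
  calc ∫ x, g x * h ‖x‖ ∂μ
      = ∫ x : ({(0 : V)}ᶜ : Set V), g x.1 * h ‖x.1‖ ∂(μ.comap (↑)) := by
        rw [integral_subtype_comap (measurableSet_singleton _).compl fun x ↦ g x * h ‖x‖,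
          restrict_compl_singleton]
    _ = ∫ x : Metric.sphere (0 : V) 1 × Set.Ioi (0 : ℝ), g x.1 * ((x.2 : ℝ) ^ p * h x.2)
          ∂μ.toSphere.prod (.volumeIoiPow N) := by
        rw [← μ.measurePreserving_homeomorphUnitSphereProd.integral_comp
          (Homeomorph.measurableEmbedding _)]
        refine integral_congr_ae (.of_forall fun x => ?_)
        have hx : 0 < ‖(x : V)‖ := norm_pos_iff.2 x.2
        have := hg ‖(x : V)‖ (‖(x : V)‖⁻¹ • (x : V)) hx
        rw [smul_smul, mul_inv_cancel₀ hx.ne', one_smul] at this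
        simp [this]
        ring
    _ = _ := by
        rw [integral_prod_mul (fun θ : Metric.sphere (0 : V) 1 => g θ)
          (fun r : Set.Ioi (0 : ℝ) => (r : ℝ) ^ p * h r)]
        congr 1
        simp only [Measure.volumeIoiPow, ENNReal.ofReal]
        rw [integral_withDensity_eq_integral_smul,
          integral_subtype_comap measurableSet_Ioi
            fun a ↦ Real.toNNReal (a ^ N) • (a ^ p * h a)]
        · refine setIntegral_congr_fun measurableSet_Ioi fun x hx ↦ ?_
          simp only [NNReal.smul_def, Real.coe_toNNReal _ (pow_nonneg (Set.mem_Ioi.1 hx).le _),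
            smul_eq_mul]
        · exact (measurable_subtype_coe.pow_const _).real_toNNReal

theorem integral_Ioi_pow_mul_exp_neg_sq (n : ℕ) :
    ∫ t in Set.Ioi (0 : ℝ), t ^ n * Real.exp (-t ^ 2) = Real.Gamma ((n + 1) / 2) / 2 := by
  have := integral_rpow_mul_exp_neg_rpow (p := 2) (q := n) two_pos
    (by linarith [n.cast_nonneg (α := ℝ)])
  simp only [Real.rpow_natCast, Real.rpow_two] at this
  rw [this]; ring

theorem integral_even_pow_mul_exp_neg_sq (m : ℕ) :
    ∫ t : ℝ, t ^ (2 * m) * Real.exp (-t ^ 2) = Real.Gamma (m + 1 / 2) := by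
  have h := integral_comp_abs (f := fun t : ℝ => t ^ (2 * m) * Real.exp (-t ^ 2))
  simp only [sq_abs, (even_two_mul m).pow_abs] at h
  rw [h, integral_Ioi_pow_mul_exp_neg_sq]
  rw [mul_div_cancel₀ _ two_ne_zero]
  congr 1
  push_cast
  ring

/-- Gaussian moments in an arbitrary direction, reduced to the first coordinate by a rotation. -/
theorem integral_inner_pow_mul_exp_neg_sq (D m : ℕ) (z : EuclideanSpace ℝ (Fin (D + 1))) :
    ∫ x : EuclideanSpace ℝ (Fin (D + 1)), inner ℝ x z ^ (2 * m) * Real.exp (-‖x‖ ^ 2) =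
      ‖z‖ ^ (2 * m) * (Real.Gamma (m + 1 / 2) * √Real.pi ^ D) := by
  obtain ⟨b, hb⟩ : ∃ b : OrthonormalBasis (Fin (D + 1)) ℝ (EuclideanSpace ℝ (Fin (D + 1))),
      ‖z‖ • b 0 = z := by
    rcases eq_or_ne z 0 with rfl | hz
    · exact ⟨EuclideanSpace.basisFun _ _, by simp⟩
    · have ho : Orthonormal ℝ (Set.domRestrict {(0 : Fin (D + 1))}
          (fun _ : Fin (D + 1) => ‖z‖⁻¹ • z)) := by
        refine ⟨fun i => by simp [norm_smul, hz], fun i j hij => absurd ?_ hij⟩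
        exact Subsingleton.elim i j
      obtain ⟨b, hb⟩ := ho.exists_orthonormalBasis_extension_of_card_eq (by simp)
      refine ⟨b, ?_⟩
      rw [hb 0 rfl, smul_smul, mul_inv_cancel₀ (norm_ne_zero_iff.2 hz), one_smul]
  have hz : ∀ x, inner ℝ x z = ‖z‖ * b.repr x 0 := by
    intro x
    rw [b.repr_apply_apply]
    conv_lhs => rw [← hb]
    rw [real_inner_smul_right, real_inner_comm]
  calc _ = ∫ x, (fun y : EuclideanSpace ℝ (Fin (D + 1)) =>
              (‖z‖ * y 0) ^ (2 * m) * Real.exp (-‖y‖ ^ 2)) (b.repr x) := by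
        simp [hz]
    _ = ∫ y : EuclideanSpace ℝ (Fin (D + 1)), (‖z‖ * y 0) ^ (2 * m) * Real.exp (-‖y‖ ^ 2) :=
        b.measurePreserving_repr.integral_comp b.repr.toHomeomorph.measurableEmbedding
          (fun y => (‖z‖ * y 0) ^ (2 * m) * Real.exp (-‖y‖ ^ 2))
    _ = ∫ y : Fin (D + 1) → ℝ, ‖z‖ ^ (2 * m) *
          ∏ i, (Fin.cons (fun t => t ^ (2 * m) * Real.exp (-t ^ 2))
            (fun _ t => Real.exp (-t ^ 2)) : Fin (D + 1) → ℝ → ℝ) i (y i) := by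
        rw [← (EuclideanSpace.volume_preserving_symm_measurableEquiv_toLp
          (Fin (D + 1))).symm.integral_comp']
        refine integral_congr_ae (.of_forall fun y => ?_)
        simp [Fin.prod_univ_succ, EuclideanSpace.norm_sq_eq, Fin.sum_univ_succ, Real.exp_add,
          Real.exp_sum, ← Finset.sum_neg_distrib]
        ring
    _ = _ := by
        rw [integral_const_mul, integral_fintype_prod_volume_eq_prod, Fin.prod_univ_succ]
        simp only [Fin.cons_zero, Fin.cons_succ, integral_even_pow_mul_exp_neg_sq]
        have := integral_gaussian 1
        simp only [neg_mul, one_mul, div_one] at this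
        simp [this]

/-- The even moments of the surface measure of the sphere. -/
theorem integral_sphere_inner_pow (D m : ℕ) (z : EuclideanSpace ℝ (Fin (D + 1))) :
    ∫ θ : UnitSphere (D + 1), inner ℝ (θ : EuclideanSpace ℝ (Fin (D + 1))) z ^ (2 * m)
      ∂sphereMeasure (D + 1) =
      2 * √Real.pi ^ D * Real.Gamma (m + 1 / 2) / Real.Gamma (m + (D + 1) / 2) *
        ‖z‖ ^ (2 * m) := by
  have h := integral_homogeneous_mul_radial (volume : Measure (EuclideanSpace ℝ (Fin (D + 1))))
    (2 * m) (fun x => inner ℝ x z ^ (2 * m))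
    (fun r x _ => by rw [real_inner_smul_left, mul_pow]) (fun r => Real.exp (-r ^ 2))
  rw [integral_inner_pow_mul_exp_neg_sq] at h
  simp only [finrank_euclideanSpace_fin, add_tsub_cancel_right, ← mul_assoc, ← pow_add] at h
  rw [integral_Ioi_pow_mul_exp_neg_sq] at h
  have e : (((D + 2 * m : ℕ) : ℝ) + 1) / 2 = m + (D + 1) / 2 := by push_cast; ring
  rw [e] at h
  have hG : 0 < Real.Gamma (m + (D + 1) / 2) := Real.Gamma_pos_of_pos (by positivity)
  rw [sphereMeasure]
  field_simp at h ⊢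
  linarith

/-! ### The Fourier transform of the surface measure -/

instance (d : ℕ) : IsFiniteMeasure (sphereMeasure d) := by
  unfold sphereMeasure; infer_instance

instance (d : ℕ) : (sphereMeasure d).IsOpenPosMeasure := by
  unfold sphereMeasure; infer_instance

theorem abs_inner_sphere_le {d : ℕ} (θ : UnitSphere d) (z : EuclideanSpace ℝ (Fin d)) :
    |inner ℝ (θ : EuclideanSpace ℝ (Fin d)) z| ≤ ‖z‖ := by
  simpa using abs_real_inner_le_norm (θ : EuclideanSpace ℝ (Fin d)) z

theorem integral_sphere_sin_inner {D : ℕ} (z : EuclideanSpace ℝ (Fin (D + 1))) :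
    ∫ θ : UnitSphere (D + 1), Real.sin (inner ℝ (θ : EuclideanSpace ℝ (Fin (D + 1))) z)
      ∂sphereMeasure (D + 1) = 0 := by
  -- Extend the odd integrand to a function homogeneous of degree `0` and integrate it against a
  -- Gaussian.
  have h := integral_homogeneous_mul_radial (volume : Measure (EuclideanSpace ℝ (Fin (D + 1))))
    0 (fun x => Real.sin (inner ℝ (‖x‖⁻¹ • x) z))
    (fun r x hr => by
      rw [norm_smul, smul_smul, Real.norm_of_nonneg hr.le, mul_inv_rev, mul_assoc,
        inv_mul_cancel₀ hr.ne', mul_one, pow_zero, one_mul]) (fun r => Real.exp (-r ^ 2))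
  have h0 := integral_neg_eq_self
    (fun x : EuclideanSpace ℝ (Fin (D + 1)) =>
      Real.sin (inner ℝ (‖x‖⁻¹ • x) z) * Real.exp (-‖x‖ ^ 2)) volume
  simp only [norm_neg, smul_neg, inner_neg_left, Real.sin_neg, neg_mul, integral_neg] at h0
  have h1 : ∫ x : EuclideanSpace ℝ (Fin (D + 1)),
      Real.sin (inner ℝ (‖x‖⁻¹ • x) z) * Real.exp (-‖x‖ ^ 2) = 0 := by linarith
  rw [h1] at h
  simp only [pow_zero, one_mul, integral_Ioi_pow_mul_exp_neg_sq, norm_eq_of_mem_sphere, inv_one,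
    one_smul] at h
  have hG : 0 < Real.Gamma
      (((Module.finrank ℝ (EuclideanSpace ℝ (Fin (D + 1))) - 1 : ℕ) + 1) / 2) :=
    Real.Gamma_pos_of_pos (by positivity)
  rcases mul_eq_zero.1 h.symm with h | h
  · exact h
  · linarith

/-- The power series of the Fourier transform of the surface measure. -/
theorem hasSum_integral_sphere_cos_inner (D : ℕ) (z : EuclideanSpace ℝ (Fin (D + 1))) :
    HasSum (fun m : ℕ => (-1) ^ m / ((2 * m)! : ℝ) *
      (2 * √Real.pi ^ D * Real.Gamma (m + 1 / 2) / Real.Gamma (m + (D + 1) / 2) * ‖z‖ ^ (2 * m)))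
      (∫ θ : UnitSphere (D + 1), Real.cos (inner ℝ (θ : EuclideanSpace ℝ (Fin (D + 1))) z)
        ∂sphereMeasure (D + 1)) := by
  have h := hasSum_integral_of_dominated_convergence (μ := sphereMeasure (D + 1))
    (F := fun m (θ : UnitSphere (D + 1)) =>
      (-1) ^ m * inner ℝ (θ : EuclideanSpace ℝ (Fin (D + 1))) z ^ (2 * m) / ((2 * m)! : ℝ))
    (f := fun θ => Real.cos (inner ℝ (θ : EuclideanSpace ℝ (Fin (D + 1))) z))
    (fun m _ => ‖z‖ ^ (2 * m) / ((2 * m)! : ℝ))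
    (fun m => by
      refine Continuous.aestronglyMeasurable ?_
      fun_prop)
    (fun m => .of_forall fun θ => by
      simp only [norm_div, norm_mul, norm_pow, norm_neg, norm_one, one_pow, one_mul,
        Real.norm_eq_abs, Nat.abs_cast]
      gcongr
      exact abs_inner_sphere_le θ z)
    (.of_forall fun θ => (Real.hasSum_cosh ‖z‖).summable)
    (integrable_const _)
    (.of_forall fun θ => Real.hasSum_cos _)
  refine h.congr_fun fun m => ?_
  rw [← integral_sphere_inner_pow, ← integral_const_mul]
  refine integral_congr_ae (.of_forall fun θ => ?_)
  ring

theorem Gamma_nat_add_half_mul (m : ℕ) :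
    Real.Gamma (m + 1 / 2) * (4 ^ m * m !) = (2 * m)! * √Real.pi := by
  induction m with
  | zero => simpa using Real.Gamma_one_half_eq
  | succ m ih =>
    have e : ((m + 1 : ℕ) : ℝ) + 1 / 2 = (m + 1 / 2) + 1 := by push_cast; ring
    rw [e, Real.Gamma_add_one (by positivity), show 2 * (m + 1) = 2 * m + 1 + 1 by ring,
      Nat.factorial_succ, Nat.factorial_succ, Nat.factorial_succ]
    push_cast
    linear_combination (4 * (m + 1 / 2) * (m + 1)) * ih

/-- In the plane, the Fourier transform of the arc length of the unit circle is `2π J₀`. -/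
theorem integral_sphere_cos_inner_two (z : EuclideanSpace ℝ (Fin 2)) :
    ∫ θ : UnitSphere 2, Real.cos (inner ℝ (θ : EuclideanSpace ℝ (Fin 2)) z) ∂sphereMeasure 2 =
      2 * Real.pi * besselJZero ‖z‖ := by
  rw [← (hasSum_integral_sphere_cos_inner 1 z).tsum_eq, besselJZero, ← tsum_mul_left]
  congr 1 with m
  have h1 : (m : ℝ) + (((1 : ℕ) : ℝ) + 1) / 2 = m + 1 := by push_cast; ring
  rw [h1, Real.Gamma_nat_eq_factorial, pow_one]
  have h2 := Gamma_nat_add_half_mul m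
  have h3 : √Real.pi ^ 2 = Real.pi := Real.sq_sqrt Real.pi_pos.le
  have h4 : (0 : ℝ) < m ! := by positivity
  have h5 : (0 : ℝ) < (2 * m)! := by positivity
  have h6 : (2 : ℝ) ^ (2 * m) = 4 ^ m := by rw [pow_mul]; norm_num
  rw [div_pow, h6]
  have h7 : Real.Gamma (m + 1 / 2) = (2 * m)! * √Real.pi / (4 ^ m * m !) := by
    field_simp at h2 ⊢; linarith
  rw [h7]
  field_simp
  rw [h3, mul_comm]

/-- In space, the Fourier transform of the surface measure of the unit sphere is `4π sinc`. -/
theorem integral_sphere_cos_inner_three (z : EuclideanSpace ℝ (Fin 3)) :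
    ∫ θ : UnitSphere 3, Real.cos (inner ℝ (θ : EuclideanSpace ℝ (Fin 3)) z) ∂sphereMeasure 3 =
      4 * Real.pi * Real.sinc ‖z‖ := by
  have h := hasSum_integral_sphere_cos_inner 2 z
  have h1 : ∀ m : ℕ, (-1) ^ m / ((2 * m)! : ℝ) * (2 * √Real.pi ^ 2 * Real.Gamma (m + 1 / 2) /
      Real.Gamma (m + (((2 : ℕ) : ℝ) + 1) / 2) * ‖z‖ ^ (2 * m)) =
      4 * Real.pi * ((-1) ^ m * ‖z‖ ^ (2 * m) / (2 * m + 1)!) := by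
    intro m
    have e : (m : ℝ) + (((2 : ℕ) : ℝ) + 1) / 2 = (m + 1 / 2) + 1 := by push_cast; ring
    have hG : 0 < Real.Gamma ((m : ℝ) + 1 / 2) := Real.Gamma_pos_of_pos (by positivity)
    rw [e, Real.Gamma_add_one (by positivity), Real.sq_sqrt Real.pi_pos.le, Nat.factorial_succ]
    push_cast
    have h5 : (0 : ℝ) < (2 * m)! := by positivity
    field_simp
    ring
  simp only [h1] at h
  rcases eq_or_ne z 0 with rfl | hz
  · have h0 : ∀ m : ℕ, m ≠ 0 → 4 * Real.pi *
        ((-1) ^ m * ‖(0 : EuclideanSpace ℝ (Fin 3))‖ ^ (2 * m) / (2 * m + 1)!) = 0 := by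
      intro m hm; simp [hm]
    rw [h.unique (hasSum_single 0 h0)]
    simp
  · have hz' : ‖z‖ ≠ 0 := norm_ne_zero_iff.2 hz
    have h2 := ((Real.hasSum_sin ‖z‖).mul_left (4 * Real.pi / ‖z‖))
    rw [Real.sinc_of_ne_zero hz']
    convert h.unique (h2.congr_fun fun m => ?_) using 1
    · ring
    · rw [pow_succ]
      field_simp

/-- The plane wave with phase vector `z`, restricted to the unit sphere. -/
def planeWave {d : ℕ} (z : EuclideanSpace ℝ (Fin d)) : C(UnitSphere d, ℂ) where
  toFun θ := Complex.exp (Complex.I * ((inner ℝ (θ : EuclideanSpace ℝ (Fin d)) z : ℝ) : ℂ))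
  continuous_toFun := by fun_prop

theorem planeWave_apply {d : ℕ} (z : EuclideanSpace ℝ (Fin d)) (θ : UnitSphere d) :
    planeWave z θ =
      Complex.exp (Complex.I * ((inner ℝ (θ : EuclideanSpace ℝ (Fin d)) z : ℝ) : ℂ)) := rfl

theorem conj_planeWave {d : ℕ} (z : EuclideanSpace ℝ (Fin d)) (θ : UnitSphere d) :
    (starRingEnd ℂ) (planeWave z θ) =
      Complex.exp (-(Complex.I * ((inner ℝ (θ : EuclideanSpace ℝ (Fin d)) z : ℝ) : ℂ))) := by
  rw [planeWave_apply, ← Complex.exp_conj]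
  simp

/-- The plane wave as an element of `L²` of the sphere. -/
def planeWaveLp {d : ℕ} (z : EuclideanSpace ℝ (Fin d)) : Lp ℂ 2 (sphereMeasure d) :=
  ContinuousMap.toLp 2 (sphereMeasure d) ℂ (planeWave z)

/-- The imaginary part of the inner product vanishes because the sine is odd on the sphere. -/
theorem inner_planeWaveLp {D : ℕ} (y z : EuclideanSpace ℝ (Fin (D + 1))) :
    inner ℂ (planeWaveLp y) (planeWaveLp z) =
      ((∫ θ : UnitSphere (D + 1),
        Real.cos (inner ℝ (θ : EuclideanSpace ℝ (Fin (D + 1))) (z - y))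
        ∂sphereMeasure (D + 1) : ℝ) : ℂ) := by
  rw [planeWaveLp, planeWaveLp, ContinuousMap.inner_toLp]
  have h1 : ∀ θ : UnitSphere (D + 1), planeWave z θ * (starRingEnd ℂ) (planeWave y θ) =
      (Real.cos (inner ℝ (θ : EuclideanSpace ℝ (Fin (D + 1))) (z - y)) : ℂ) +
      (Real.sin (inner ℝ (θ : EuclideanSpace ℝ (Fin (D + 1))) (z - y)) : ℂ) * Complex.I := by
    intro θ
    rw [conj_planeWave, planeWave_apply, ← Complex.exp_add, Complex.ofReal_cos, Complex.ofReal_sin,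
      ← Complex.exp_mul_I, inner_sub_right]
    push_cast
    ring_nf
  have hi : ∀ {f : UnitSphere (D + 1) → ℂ}, Continuous f → Integrable f (sphereMeasure (D + 1)) :=
    fun hf => hf.integrable_of_hasCompactSupport (HasCompactSupport.of_compactSpace _)
  simp only [h1]
  rw [integral_add (hi (by fun_prop)) (hi (by fun_prop)), integral_mul_const,
    integral_complex_ofReal, integral_complex_ofReal, integral_sphere_sin_inner]
  simp

/-! ### The outgoing Green function near and away from its singularity -/

theorem differentiable_tsum_mul_pow {a : ℕ → ℝ} (ha : ∀ m, |a m| ≤ 1 / m !) :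
    Differentiable ℝ fun t : ℝ => ∑' m, a m * t ^ m := by
  intro t
  set R : ℝ := |t| + 1
  have hu : Summable fun n : ℕ => 1 / (n ! : ℝ) * (n * R ^ (n - 1)) := by
    rw [← summable_nat_add_iff 1]
    refine (Real.summable_pow_div_factorial R).congr fun n => ?_
    rw [Nat.factorial_succ, Nat.add_sub_cancel]
    push_cast
    have : (0 : ℝ) < n ! := by positivity
    field_simp
  have h := hasDerivAt_tsum_of_isPreconnected (u := fun n : ℕ => 1 / (n ! : ℝ) * (n * R ^ (n - 1)))
    (g := fun n t => a n * t ^ n) (g' := fun n t => a n * (n * t ^ (n - 1)))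
    (t := Metric.ball 0 R) (y₀ := 0) (y := t)
    hu Metric.isOpen_ball (convex_ball _ _).isPreconnected
    (fun n y _ => (hasDerivAt_pow n y).const_mul (a n))
    (fun n y hy => by
      rw [norm_mul, norm_mul, norm_pow, Real.norm_natCast, Real.norm_eq_abs]
      have hy' : ‖y‖ ≤ R := (mem_ball_zero_iff.1 hy).le
      gcongr
      exact ha n)
    (Metric.mem_ball_self (by positivity))
    (summable_of_ne_finset_zero (s := {0}) fun n hn => by
      rw [zero_pow (by simpa using hn), mul_zero])
    (by simp [R])
  exact h.differentiableAt

/-- `J₀ x` as a function of `(x / 2) ^ 2`. -/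
def besselJZeroSeries (t : ℝ) : ℝ := ∑' m : ℕ, (-1 : ℝ) ^ m / (m ! : ℝ) ^ 2 * t ^ m

/-- The harmonic part of the series of `Y₀ x` as a function of `(x / 2) ^ 2`. -/
def besselYZeroSeries (t : ℝ) : ℝ :=
  ∑' m : ℕ, (-1 : ℝ) ^ m * (harmonic m : ℝ) / (m ! : ℝ) ^ 2 * t ^ m

theorem besselJZero_eq (x : ℝ) : besselJZero x = besselJZeroSeries ((x / 2) ^ 2) := by
  simp only [besselJZero, besselJZeroSeries, pow_mul]

theorem besselYZero_eq (x : ℝ) : besselYZero x =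
    2 / Real.pi * ((Real.log (x / 2) + Real.eulerMascheroniConstant) *
      besselJZeroSeries ((x / 2) ^ 2) - besselYZeroSeries ((x / 2) ^ 2)) := by
  simp only [besselYZero, besselJZero_eq, besselYZeroSeries, pow_mul]

theorem harmonic_le_self (m : ℕ) : harmonic m ≤ m := by
  rw [harmonic_eq_sum_Icc]
  calc ∑ i ∈ Finset.Icc 1 m, ((i : ℚ))⁻¹ ≤ ∑ i ∈ Finset.Icc 1 m, 1 :=
        Finset.sum_le_sum fun i hi => inv_le_one_of_one_le₀ (by
          exact_mod_cast (Finset.mem_Icc.1 hi).1)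
    _ = m := by simp

theorem differentiable_besselJZeroSeries : Differentiable ℝ besselJZeroSeries := by
  refine differentiable_tsum_mul_pow fun m => ?_
  rw [abs_div, abs_pow, abs_neg, abs_one, one_pow, abs_of_nonneg (by positivity)]
  have h1 : (1 : ℝ) ≤ m ! := by exact_mod_cast Nat.one_le_iff_ne_zero.2 m.factorial_ne_zero
  gcongr
  nlinarith

theorem differentiable_besselYZeroSeries : Differentiable ℝ besselYZeroSeries := by
  refine differentiable_tsum_mul_pow fun m => ?_
  have h0 : (0 : ℝ) ≤ harmonic m := by
    rw [harmonic_eq_sum_Icc]; push_cast; positivity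
  rw [abs_div, abs_mul, abs_pow, abs_neg, abs_one, one_pow, one_mul,
    abs_of_nonneg (by positivity : (0 : ℝ) ≤ (m ! : ℝ) ^ 2), abs_of_nonneg h0]
  have h1 : (0 : ℝ) < m ! := by positivity
  have h2 : (harmonic m : ℝ) ≤ m ! := by
    calc (harmonic m : ℝ) ≤ m := by exact_mod_cast harmonic_le_self m
      _ ≤ m ! := by exact_mod_cast m.self_le_factorial
  rw [div_le_div_iff₀ (by positivity) h1]
  nlinarith

theorem besselJZeroSeries_zero : besselJZeroSeries 0 = 1 := by
  rw [besselJZeroSeries, tsum_eq_single 0 (fun m hm => by simp [hm])]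
  simp

theorem besselYZeroSeries_zero : besselYZeroSeries 0 = 0 := by
  rw [besselYZeroSeries, tsum_eq_single 0 (fun m hm => by simp [hm])]
  simp

theorem outgoingGreen_two (κ r : ℝ) : outgoingGreen 2 κ r =
    ((1 / (2 * Real.pi) * ((Real.log (κ * r / 2) + Real.eulerMascheroniConstant) *
      besselJZeroSeries ((κ * r / 2) ^ 2) - besselYZeroSeries ((κ * r / 2) ^ 2)) : ℝ) : ℂ)
      - Complex.I / 4 * (besselJZeroSeries ((κ * r / 2) ^ 2) : ℝ) := by
  rw [outgoingGreen, if_pos rfl, hankelOneZero, besselYZero_eq, besselJZero_eq]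
  push_cast
  have hpi : (Real.pi : ℂ) ≠ 0 := by exact_mod_cast Real.pi_ne_zero
  field_simp
  ring_nf
  rw [Complex.I_sq]
  ring

theorem outgoingGreen_three (κ r : ℝ) : outgoingGreen 3 κ r =
    -Complex.exp (Complex.I * ((κ * r : ℝ) : ℂ)) / ((4 * Real.pi * r : ℝ) : ℂ) := by
  rw [outgoingGreen, if_neg (by norm_num)]

theorem DifferentiableAt.ofReal_comp {f : ℝ → ℝ} {r : ℝ} (hf : DifferentiableAt ℝ f r) :
    DifferentiableAt ℝ (fun r => (f r : ℂ)) r :=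
  hf.hasDerivAt.ofReal_comp.differentiableAt

theorem differentiableAt_outgoingGreen {d : ℕ} (hd : d = 2 ∨ d = 3) {κ r : ℝ} (hκ : 0 < κ)
    (hr : 0 < r) : DifferentiableAt ℝ (outgoingGreen d κ) r := by
  rcases hd with rfl | rfl
  · have hJ : DifferentiableAt ℝ (fun r => besselJZeroSeries ((κ * r / 2) ^ 2)) r :=
      (differentiable_besselJZeroSeries _).comp (f := fun r => (κ * r / 2) ^ 2) r (by fun_prop)
    have hY : DifferentiableAt ℝ (fun r => besselYZeroSeries ((κ * r / 2) ^ 2)) r :=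
      (differentiable_besselYZeroSeries _).comp (f := fun r => (κ * r / 2) ^ 2) r (by fun_prop)
    have hL : DifferentiableAt ℝ (fun r => Real.log (κ * r / 2)) r :=
      DifferentiableAt.log (by fun_prop) (by positivity)
    rw [funext (outgoingGreen_two κ)]
    refine DifferentiableAt.sub ?_ ?_
    · exact DifferentiableAt.ofReal_comp (by fun_prop)
    · exact hJ.ofReal_comp.const_mul _
  · rw [funext (outgoingGreen_three κ)]
    have h1 : ∀ c : ℝ, DifferentiableAt ℝ (fun r : ℝ => ((c * r : ℝ) : ℂ)) r := fun c =>
      DifferentiableAt.ofReal_comp (by fun_prop)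
    refine DifferentiableAt.div ?_ (h1 _) ?_
    · exact (((h1 κ).const_mul _).cexp).neg
    · exact_mod_cast (by positivity : 4 * Real.pi * r ≠ 0)

/-- The coefficient of the singular term in the expansion of the Green function at its
singularity. -/
def greenSingularCoeff (d : ℕ) : ℝ := if d = 2 then 1 / (2 * Real.pi) else -1 / (4 * Real.pi)

/-- The constant term in the expansion of the Green function at its singularity. -/
def greenRegularCoeff (d : ℕ) (κ : ℝ) : ℂ :=
  if d = 2 then
    (((Real.log (κ / 2) + Real.eulerMascheroniConstant) / (2 * Real.pi) : ℝ) : ℂ) - Complex.I / 4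
  else -Complex.I * ((κ / (4 * Real.pi) : ℝ) : ℂ)

theorem isBigO_comp_sq_sub {g : ℝ → ℝ} (hg : DifferentiableAt ℝ g 0) (c : ℝ) :
    (fun r : ℝ => g ((c * r / 2) ^ 2) - g 0) =O[𝓝 0] fun r => r ^ 2 := by
  have h1 : Filter.Tendsto (fun r : ℝ => (c * r / 2) ^ 2) (𝓝 0) (𝓝 0) := by
    have : Continuous fun r : ℝ => (c * r / 2) ^ 2 := by fun_prop
    simpa using this.tendsto 0
  have h2 := hg.isBigO_sub.comp_tendsto h1
  refine h2.trans ?_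
  refine Asymptotics.IsBigO.of_bound (c ^ 2 / 4) (.of_forall fun r => ?_)
  simp only [Function.comp_apply, sub_zero, norm_pow, norm_div, norm_mul, Real.norm_eq_abs,
    sq_abs, div_pow, mul_pow]
  norm_num
  linarith

theorem isBigO_outgoingGreen {d : ℕ} (hd : d = 2 ∨ d = 3) {κ : ℝ} (hκ : 0 < κ) :
    (fun r : ℝ => outgoingGreen d κ r -
      ((greenSingularCoeff d : ℂ) * (pointSingularity d r : ℂ) + greenRegularCoeff d κ))
      =O[𝓝[>] 0] fun r => r := by
  rcases hd with rfl | rfl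
  · set J := fun r : ℝ => besselJZeroSeries ((κ * r / 2) ^ 2) - 1
    set Y := fun r : ℝ => besselYZeroSeries ((κ * r / 2) ^ 2)
    have hsq : (fun r : ℝ => r ^ 2) =O[𝓝[>] 0] fun r => r := by
      have : (fun r : ℝ => r ^ 2) =O[𝓝 0] fun r => r := by
        simpa using (Asymptotics.isBigO_refl (fun r : ℝ => r) (𝓝 0)).mul
          ((continuous_id.tendsto (0 : ℝ)).isBigO_one ℝ) |>.congr_left fun r => (sq r).symm
      exact this.mono nhdsWithin_le_nhds
    have hJ : J =O[𝓝[>] 0] fun r => r ^ 2 := by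
      simpa [besselJZeroSeries_zero] using
        (isBigO_comp_sq_sub (differentiable_besselJZeroSeries 0) κ).mono nhdsWithin_le_nhds
    have hY : Y =O[𝓝[>] 0] fun r => r ^ 2 := by
      simpa [besselYZeroSeries_zero] using
        (isBigO_comp_sq_sub (differentiable_besselYZeroSeries 0) κ).mono nhdsWithin_le_nhds
    have hlog : (fun r : ℝ => Real.log r * J r) =O[𝓝[>] 0] fun r => r := by
      have h1 : (fun r : ℝ => Real.log r * r) =O[𝓝[>] 0] fun _ => (1 : ℝ) :=
        (((by simpa using Real.continuous_mul_log.tendsto 0 :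
        Filter.Tendsto (fun r : ℝ => r * Real.log r) (𝓝 0) (𝓝 0)).isBigO_one ℝ).mono
          nhdsWithin_le_nhds).congr_left fun r => mul_comm _ _
      refine ((Asymptotics.isBigO_refl Real.log _).mul hJ).trans ?_
      simpa using (h1.mul (Asymptotics.isBigO_refl (fun r : ℝ => r) _)).congr_left
        fun r => by ring
    have hre : (fun r : ℝ => 1 / (2 * Real.pi) * (Real.log r * J r +
        (Real.log (κ / 2) + Real.eulerMascheroniConstant) * J r - Y r)) =O[𝓝[>] 0] fun r => r :=
      ((hlog.add ((hJ.trans hsq).const_mul_left _)).sub (hY.trans hsq)).const_mul_left _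
    have h := (Asymptotics.IsBigO.sub (Complex.isBigO_ofReal_left.2 hre)
      ((Complex.isBigO_ofReal_left.2 (hJ.trans hsq)).const_mul_left (Complex.I / 4)))
    refine h.congr' ?_ .rfl
    filter_upwards [self_mem_nhdsWithin] with r hr
    have hr : 0 < r := hr
    have hl : Real.log (κ * r / 2) = Real.log (κ / 2) + Real.log r := by
      rw [← Real.log_mul (by positivity) hr.ne']; ring_nf
    rw [outgoingGreen_two, greenSingularCoeff, greenRegularCoeff, pointSingularity, if_pos rfl,
      if_pos rfl, if_pos rfl, hl]
    simp only [J, Y]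
    push_cast
    have hpi : (Real.pi : ℂ) ≠ 0 := by exact_mod_cast Real.pi_ne_zero
    field_simp
    ring
  · refine Asymptotics.IsBigO.of_bound (κ ^ 2 / (4 * Real.pi)) ?_
    have hs : ∀ᶠ r : ℝ in 𝓝[>] 0, r < 1 / κ :=
      nhdsWithin_le_nhds (eventually_lt_nhds (by positivity))
    filter_upwards [self_mem_nhdsWithin, hs] with r hr hr1
    have hr : 0 < r := hr
    have hpi : (Real.pi : ℂ) ≠ 0 := by exact_mod_cast Real.pi_ne_zero
    have hrc : (r : ℂ) ≠ 0 := by exact_mod_cast hr.ne'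
    have hn : ‖Complex.I * ((κ * r : ℝ) : ℂ)‖ = κ * r := by
      rw [norm_mul, Complex.norm_I, one_mul, Complex.norm_real, Real.norm_of_nonneg (by positivity)]
    have hle := Complex.norm_exp_sub_one_sub_id_le (x := Complex.I * ((κ * r : ℝ) : ℂ)) (by
      rw [hn]; rw [lt_div_iff₀ hκ] at hr1; linarith)
    rw [hn] at hle
    have e : outgoingGreen 3 κ r - ((greenSingularCoeff 3 : ℂ) * (pointSingularity 3 r : ℂ) +
        greenRegularCoeff 3 κ) = -(Complex.exp (Complex.I * ((κ * r : ℝ) : ℂ)) - 1 -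
          Complex.I * ((κ * r : ℝ) : ℂ)) / ((4 * Real.pi * r : ℝ) : ℂ) := by
      rw [outgoingGreen_three, greenSingularCoeff, greenRegularCoeff, pointSingularity,
        if_neg (by norm_num), if_neg (by norm_num), if_neg (by norm_num)]
      push_cast
      field_simp
      ring
    rw [e, norm_div, norm_neg, Complex.norm_real, Real.norm_of_nonneg (by positivity),
      Real.norm_of_nonneg hr.le, div_le_iff₀ (by positivity)]
    refine hle.trans (le_of_eq ?_)
    field_simp

/-- The imaginary part of the Green function, extended continuously to its singularity, is a
negative multiple of the Fourier transform of the surface measure of the sphere. -/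
theorem exists_im_green_eq_inner {d : ℕ} (hd : d = 2 ∨ d = 3) {κ : ℝ} (hκ : 0 < κ) :
    ∃ w : ℝ, 0 < w ∧ ∀ y z : EuclideanSpace ℝ (Fin d),
      (((if y = z then greenRegularCoeff d κ else outgoingGreen d κ ‖y - z‖).im : ℝ) : ℂ) =
        -w * inner ℂ (planeWaveLp (κ • y)) (planeWaveLp (κ • z)) := by
  have hn : ∀ {d : ℕ} (y z : EuclideanSpace ℝ (Fin d)), ‖κ • z - κ • y‖ = κ * ‖y - z‖ := by
    intro d y z
    rw [← smul_sub, norm_smul, Real.norm_of_nonneg hκ.le, norm_sub_rev]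
  rcases hd with rfl | rfl
  · refine ⟨1 / (8 * Real.pi), by positivity, fun y z => ?_⟩
    rw [inner_planeWaveLp, integral_sphere_cos_inner_two, hn, besselJZero_eq]
    norm_cast
    split_ifs with h
    · subst h
      simp only [greenRegularCoeff, if_pos, sub_self, norm_zero, mul_zero, zero_div,
        Complex.sub_im, Complex.ofReal_im, zero_sub]
      norm_num [besselJZeroSeries_zero]
      field_simp
      norm_num
    · rw [outgoingGreen_two]
      simp only [Complex.sub_im, Complex.ofReal_im, Complex.im_mul_ofReal]
      norm_num
      field_simp
      norm_num
      exact mul_comm _ _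
  · refine ⟨κ / (16 * Real.pi ^ 2), by positivity, fun y z => ?_⟩
    rw [inner_planeWaveLp, integral_sphere_cos_inner_three, hn]
    norm_cast
    split_ifs with h
    · subst h
      rw [greenRegularCoeff, if_neg (by norm_num), Complex.im_mul_ofReal]
      simp
      field_simp
      norm_num
    · have hr : 0 < ‖y - z‖ := norm_pos_iff.2 (sub_ne_zero.2 h)
      rw [outgoingGreen_three, Complex.div_ofReal_im, Complex.neg_im, mul_comm Complex.I,
        Complex.exp_ofReal_mul_I_im, Real.sinc_of_ne_zero (by positivity)]
      field_simp
      norm_num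

/-! ### Linear independence of plane waves on the sphere -/

/-- A finite set of points of a space of dimension at least two is separated by the second
coordinate of some orthonormal pair. -/
theorem exists_orthonormal_pair_separating {V : Type*} [NormedAddCommGroup V]
    [InnerProductSpace ℝ V] [FiniteDimensional ℝ V] (hV : 2 ≤ Module.finrank ℝ V)
    (s : Finset V) :
    ∃ a b : V, ‖a‖ = 1 ∧ ‖b‖ = 1 ∧ inner ℝ a b = 0 ∧
      ∀ y ∈ s, ∀ z ∈ s, y ≠ z → inner ℝ b y ≠ inner ℝ b z := by
  classical
  have : Nontrivial V := Module.nontrivial_of_finrank_pos (R := ℝ) (by omega)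
  obtain ⟨e, he⟩ := exists_ne (0 : V)
  -- The extra pair `(e, 0)` makes the separating functional nonzero when `s` has no two points.
  obtain ⟨f, hf⟩ := Module.exists_dual_forall_apply_ne_zero (K := ℝ)
    (fun p : (insert (e, 0) s.offDiag : Finset (V × V)) => p.1.1 - p.1.2) (by
      rintro ⟨⟨y, z⟩, h⟩
      rcases Finset.mem_insert.1 h with h | h
      · obtain ⟨rfl, rfl⟩ := Prod.mk.inj h
        simpa using he
      · exact sub_ne_zero.2 (Finset.mem_offDiag.1 h).2.2)
  set c : V := (InnerProductSpace.toDual ℝ V).symm (LinearMap.toContinuousLinearMap f)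
  have hc : ∀ x, inner ℝ c x = f x := fun x => by simp [c]
  have hc0 : c ≠ 0 := by
    intro h
    have h1 := hf ⟨(e, 0), Finset.mem_insert_self _ _⟩
    have h2 := hc (e - 0)
    rw [h, inner_zero_left] at h2
    exact h1 h2.symm
  have hF : (ℝ ∙ c)ᗮ ≠ ⊥ := by
    intro h
    have h1 := Submodule.finrank_add_finrank_orthogonal (ℝ ∙ c)
    rw [h, finrank_bot, finrank_span_singleton hc0] at h1
    omega
  obtain ⟨a, ha, ha0⟩ := Submodule.exists_mem_ne_zero_of_ne_bot hF
  rw [Submodule.mem_orthogonal_singleton_iff_inner_left] at ha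
  refine ⟨‖a‖⁻¹ • a, ‖c‖⁻¹ • c, norm_smul_inv_norm ha0, norm_smul_inv_norm hc0, ?_, ?_⟩
  · simp [real_inner_smul_left, real_inner_smul_right, ha]
  · intro y hy z hz hyz h
    rw [real_inner_smul_left, real_inner_smul_left] at h
    have h1 := mul_left_cancel₀ (inv_ne_zero (norm_ne_zero_iff.2 hc0)) h
    rw [hc, hc] at h1
    refine hf ⟨(y, z), Finset.mem_insert_of_mem (Finset.mem_offDiag.2 ⟨hy, hz, hyz⟩)⟩ ?_
    rw [map_sub, h1, sub_self]

/-- Distinct plane waves are linearly independent on the unit sphere: on a great circle the phase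
is `cos φ ⟪a, z⟫ + sin φ ⟪b, z⟫`, and on the analytic continuation to `φ = i t` the wave with the
smallest `⟪b, z⟫` dominates all others as `t → ∞`. -/
theorem linearIndependent_planeWave {d : ℕ} (hd : 2 ≤ d) :
    LinearIndependent ℂ (planeWave : EuclideanSpace ℝ (Fin d) → C(UnitSphere d, ℂ)) := by
  classical
  rw [linearIndependent_iff']
  intro s g hg
  by_contra! hne
  set s' := s.filter fun z => g z ≠ 0
  have hs' : s'.Nonempty := by
    obtain ⟨z, hz, hz0⟩ := hne
    exact ⟨z, Finset.mem_filter.2 ⟨hz, hz0⟩⟩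
  obtain ⟨a, b, ha, hb, hab, hsep⟩ := exists_orthonormal_pair_separating (by simpa using hd) s'
  obtain ⟨z₀, hz₀, hmin⟩ := s'.exists_min_image (fun z => inner ℝ b z) hs'
  set F : ℂ → ℂ := fun w => ∑ z ∈ s', g z * Complex.exp (Complex.I *
    (Complex.cos w * ((inner ℝ a z : ℝ) : ℂ) + Complex.sin w * ((inner ℝ b z : ℝ) : ℂ)))
  have hreal : ∀ t : ℝ, F t = 0 := by
    intro t
    have hθ : Real.cos t • a + Real.sin t • b ∈ Metric.sphere (0 : EuclideanSpace ℝ (Fin d)) 1 := by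
      rw [mem_sphere_zero_iff_norm, ← sq_eq_sq₀ (norm_nonneg _) zero_le_one, norm_add_sq_real]
      simp [norm_smul, ha, hb, real_inner_smul_left, real_inner_smul_right, hab]
    have h := congrArg (fun f : C(UnitSphere d, ℂ) => f ⟨_, hθ⟩) hg
    simp only [ContinuousMap.coe_sum, ContinuousMap.coe_smul, Finset.sum_apply, Pi.smul_apply,
      smul_eq_mul, ContinuousMap.zero_apply, planeWave_apply] at h
    rw [← h]
    simp only [F, s']
    rw [Finset.sum_filter]
    refine Finset.sum_congr rfl fun z _ => ?_
    split_ifs with hz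
    · rw [inner_add_left, real_inner_smul_left, real_inner_smul_left]
      push_cast
      rfl
    · rw [not_not.1 hz, zero_mul]
  have hF : F = 0 := by
    have hdF : Differentiable ℂ F := by
      simp only [F]; fun_prop
    refine AnalyticOnNhd.eq_of_frequently_eq (z₀ := 0)
      (fun w _ => hdF.analyticAt w) (fun w _ => analyticAt_const) ?_
    have ht : Filter.Tendsto (fun t : ℝ => (t : ℂ)) (𝓝[≠] 0) (𝓝[≠] 0) := by
      refine tendsto_nhdsWithin_iff.2 ⟨?_, ?_⟩
      · exact (Complex.continuous_ofReal.tendsto' 0 0 (by simp)).mono_left nhdsWithin_le_nhds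
      · filter_upwards [self_mem_nhdsWithin] with t ht
        simpa using ht
    exact ht.frequently (Filter.Eventually.frequently (.of_forall hreal))
  have hlim : Filter.Tendsto (fun t : ℝ => F (t * Complex.I) * Complex.exp (-(Complex.I *
      (Complex.cosh t * ((inner ℝ a z₀ : ℝ) : ℂ) +
        Complex.sinh t * Complex.I * ((inner ℝ b z₀ : ℝ) : ℂ))))) Filter.atTop
      (𝓝 (∑ z ∈ s', if z = z₀ then g z₀ else 0)) := by
    simp only [F, Finset.sum_mul]
    refine tendsto_finsetSum _ fun z hz => ?_
    have he : ∀ t : ℝ, g z * Complex.exp (Complex.I * (Complex.cos (t * Complex.I) *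
        ((inner ℝ a z : ℝ) : ℂ) + Complex.sin (t * Complex.I) * ((inner ℝ b z : ℝ) : ℂ))) *
        Complex.exp (-(Complex.I * (Complex.cosh t * ((inner ℝ a z₀ : ℝ) : ℂ) +
        Complex.sinh t * Complex.I * ((inner ℝ b z₀ : ℝ) : ℂ)))) =
        g z * Complex.exp (((-(Real.sinh t * (inner ℝ b z - inner ℝ b z₀)) : ℝ) : ℂ) +
          ((Real.cosh t * (inner ℝ a z - inner ℝ a z₀) : ℝ) : ℂ) * Complex.I) := by
      intro t
      rw [mul_assoc, ← Complex.exp_add, Complex.cos_mul_I, Complex.sin_mul_I]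
      congr 2
      push_cast
      linear_combination (Complex.sinh t * ((inner ℝ b z : ℝ) : ℂ) -
        Complex.sinh t * ((inner ℝ b z₀ : ℝ) : ℂ)) * Complex.I_sq
    simp only [he]
    split_ifs with hzz
    · subst hzz
      simp
    · have hpos : 0 < inner ℝ b z - inner ℝ b z₀ :=
        sub_pos.2 (lt_of_le_of_ne (hmin z hz) (hsep z₀ hz₀ z hz (Ne.symm hzz)))
      rw [tendsto_zero_iff_norm_tendsto_zero]
      simp only [norm_mul, Complex.norm_exp, Complex.add_re, Complex.ofReal_re, Complex.mul_re,
        Complex.I_re, Complex.I_im, Complex.ofReal_im, mul_zero, mul_one, sub_zero, add_zero]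
      have hsinh : Filter.Tendsto Real.sinh Filter.atTop Filter.atTop :=
        Filter.tendsto_atTop_mono' _ ((Filter.eventually_ge_atTop 0).mono fun t ht =>
          Real.self_le_sinh_iff.2 ht) Filter.tendsto_id
      simpa using (Real.tendsto_exp_neg_atTop_nhds_zero.comp
        (hsinh.atTop_mul_const hpos)).const_mul ‖g z‖
  rw [Finset.sum_ite_eq' s' z₀, if_pos hz₀] at hlim
  simp only [hF, Pi.zero_apply, zero_mul] at hlim
  exact (Finset.mem_filter.1 hz₀).2 (tendsto_nhds_unique hlim tendsto_const_nhds)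

theorem linearIndependent_planeWaveLp {d : ℕ} (hd : 2 ≤ d) :
    LinearIndependent ℂ (planeWaveLp : EuclideanSpace ℝ (Fin d) → Lp ℂ 2 (sphereMeasure d)) := by
  have hker : LinearMap.ker
      (ContinuousMap.toLp (E := ℂ) 2 (sphereMeasure d) ℂ).toLinearMap = ⊥ :=
    LinearMap.ker_eq_bot.2 (ContinuousMap.toLp_injective (sphereMeasure d))
  exact (linearIndependent_planeWave hd).map' _ hker

theorem not_finiteDimensional_Lp_sphere {d : ℕ} (hd : 2 ≤ d) :
    ¬ FiniteDimensional ℂ (Lp ℂ 2 (sphereMeasure d)) := by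
  intro h
  have : Nonempty (Fin d) := ⟨⟨0, by omega⟩⟩
  have hf := (linearIndependent_planeWaveLp hd).finite
  exact not_finite (EuclideanSpace ℝ (Fin d))

/-! ### The point conditions as linear equations -/

theorem tendsto_norm_sub_nhdsNE {V : Type*} [NormedAddCommGroup V] (y : V) :
    Filter.Tendsto (fun x => ‖x - y‖) (𝓝[≠] y) (𝓝[>] 0) := by
  refine tendsto_nhdsWithin_iff.2 ⟨?_, ?_⟩
  · have : Continuous fun x : V => ‖x - y‖ := by fun_prop
    exact (this.tendsto' y 0 (by simp)).mono_left nhdsWithin_le_nhds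
  · filter_upwards [self_mem_nhdsWithin] with x hx
    exact norm_pos_iff.2 (sub_ne_zero.2 hx)

theorem tendsto_pointSingularity_inv (d : ℕ) :
    Filter.Tendsto (fun r => (pointSingularity d r)⁻¹) (𝓝[>] 0) (𝓝 0) := by
  unfold pointSingularity
  split_ifs
  · exact tendsto_inv_atBot_zero.comp Real.tendsto_log_nhdsGT_zero
  · simp only [one_div, inv_inv]
    exact (continuous_id.tendsto (0 : ℝ)).mono_left nhdsWithin_le_nhds

theorem eventually_pointSingularity_ne_zero (d : ℕ) :
    ∀ᶠ r in 𝓝[>] 0, pointSingularity d r ≠ 0 := by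
  filter_upwards [Ioo_mem_nhdsGT (zero_lt_one (α := ℝ))] with r hr
  unfold pointSingularity
  split_ifs
  · exact (Real.log_neg hr.1 hr.2).ne
  · exact one_div_ne_zero hr.1.ne'

/-- The coefficients of the expansion at a point scatterer are determined by the function. -/
theorem pointExpansion_coeff_eq_zero {d : ℕ} [Nontrivial (EuclideanSpace ℝ (Fin d))]
    (y : EuclideanSpace ℝ (Fin d)) {s c : ℂ}
    (h : (fun x => s * (pointSingularity d ‖x - y‖ : ℂ) + c) =O[𝓝[≠] y] fun x => ‖x - y‖) :
    s = 0 ∧ c = 0 := by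
  have : (𝓝[≠] y).NeBot := Module.punctured_nhds_neBot ℝ _ y
  have hr := tendsto_norm_sub_nhdsNE y
  have h0 : Filter.Tendsto (fun x => s * (pointSingularity d ‖x - y‖ : ℂ) + c) (𝓝[≠] y) (𝓝 0) :=
    h.trans_tendsto (hr.mono_right nhdsWithin_le_nhds)
  have hinv : Filter.Tendsto (fun x => (((pointSingularity d ‖x - y‖)⁻¹ : ℝ) : ℂ)) (𝓝[≠] y)
      (𝓝 0) := by
    exact (Complex.continuous_ofReal.tendsto' 0 0 (by simp)).comp
      ((tendsto_pointSingularity_inv d).comp hr)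
  have hs : s = 0 := by
    have h1 : Filter.Tendsto (fun x => (s * (pointSingularity d ‖x - y‖ : ℂ) + c) *
        (((pointSingularity d ‖x - y‖)⁻¹ : ℝ) : ℂ) - c *
        (((pointSingularity d ‖x - y‖)⁻¹ : ℝ) : ℂ)) (𝓝[≠] y) (𝓝 0) := by
      simpa using (h0.mul hinv).sub (hinv.const_mul c)
    refine tendsto_nhds_unique (tendsto_const_nhds.congr' ?_) h1
    filter_upwards [hr.eventually (eventually_pointSingularity_ne_zero d)] with x hx
    have hx' : (pointSingularity d ‖x - y‖ : ℂ) ≠ 0 := by exact_mod_cast hx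
    push_cast
    field_simp
    ring
  refine ⟨hs, ?_⟩
  simpa [hs] using tendsto_nhds_unique tendsto_const_nhds
    (h0.congr fun x => by rw [hs, zero_mul, zero_add])

theorem DifferentiableAt.isBigO_sub_norm {V F : Type*} [NormedAddCommGroup V] [NormedSpace ℝ V]
    [NormedAddCommGroup F] [NormedSpace ℝ F] {f : V → F} {y : V} (hf : DifferentiableAt ℝ f y) :
    (fun x => f x - f y) =O[𝓝[≠] y] fun x => ‖x - y‖ :=
  (hf.isBigO_sub.mono nhdsWithin_le_nhds).norm_right

namespace MultipointScatterer

variable {d n : ℕ}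

/-- The Green function between the scatterers, with the constant term of its expansion on the
diagonal. -/
def greenMatrix (v : MultipointScatterer d n) (κ : ℝ) : Matrix (Fin n) (Fin n) ℂ :=
  .of fun j m => if v.y j = v.y m then greenRegularCoeff d κ
    else outgoingGreen d κ ‖v.y j - v.y m‖

theorem greenMatrix_comm (v : MultipointScatterer d n) (κ : ℝ) (j m : Fin n) :
    v.greenMatrix κ j m = v.greenMatrix κ m j := by
  simp [greenMatrix, eq_comm, norm_sub_rev]

/-- The expansion of the wave at a scatterer. -/
theorem wave_expansion (hd : d = 2 ∨ d = 3) (v : MultipointScatterer d n)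
    {k : EuclideanSpace ℝ (Fin d)} (hk : 0 < ‖k‖) (q : Fin n → ℂ) (j : Fin n) :
    (fun x => v.wave k q x - (greenSingularCoeff d * q j * (pointSingularity d ‖x - v.y j‖ : ℂ) +
      (Complex.exp (Complex.I * ((inner ℝ k (v.y j) : ℝ) : ℂ)) +
        ∑ m, v.greenMatrix ‖k‖ j m * q m))) =O[𝓝[≠] v.y j] fun x => ‖x - v.y j‖ := by
  have h1 : (fun x => Complex.exp (Complex.I * ((inner ℝ k x : ℝ) : ℂ)) -
      Complex.exp (Complex.I * ((inner ℝ k (v.y j) : ℝ) : ℂ))) =O[𝓝[≠] v.y j]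
        fun x => ‖x - v.y j‖ := by
    refine DifferentiableAt.isBigO_sub_norm
      (f := fun x => Complex.exp (Complex.I * ((inner ℝ k x : ℝ) : ℂ))) ?_
    have : DifferentiableAt ℝ (fun x => ((inner ℝ k x : ℝ) : ℂ)) (v.y j) :=
      Complex.ofRealCLM.differentiableAt.comp (v.y j)
        ((differentiableAt_const k).inner ℝ differentiableAt_id)
    exact (this.const_mul _).cexp
  have h2 : ∀ m, (fun x => q m * (outgoingGreen d ‖k‖ ‖x - v.y m‖ -
      ((if m = j then (greenSingularCoeff d : ℂ) * (pointSingularity d ‖x - v.y j‖ : ℂ) else 0) +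
        v.greenMatrix ‖k‖ j m))) =O[𝓝[≠] v.y j] fun x => ‖x - v.y j‖ := by
    intro m
    refine Asymptotics.IsBigO.const_mul_left ?_ _
    by_cases hm : m = j
    · subst hm
      simpa [greenMatrix, Function.comp_def] using
        (isBigO_outgoingGreen hd hk).comp_tendsto (tendsto_norm_sub_nhdsNE (v.y m))
    · have hy : v.y j ≠ v.y m := fun h => hm (v.y_injective h).symm
      have hr : 0 < ‖v.y j - v.y m‖ := norm_pos_iff.2 (sub_ne_zero.2 hy)
      have hdiff : DifferentiableAt ℝ (fun x => outgoingGreen d ‖k‖ ‖x - v.y m‖) (v.y j) :=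
        (differentiableAt_outgoingGreen hd hk hr).comp (v.y j)
          (f := fun x => ‖x - v.y m‖)
          ((differentiableAt_id.sub_const _).norm ℝ (sub_ne_zero.2 hy))
      simpa [greenMatrix, hm, hy] using hdiff.isBigO_sub_norm
  refine (h1.add (Asymptotics.IsBigO.fun_sum (s := Finset.univ) fun m _ => h2 m)).congr_left
    fun x => ?_
  have h3 : ∑ m, q m * (if m = j then (greenSingularCoeff d : ℂ) *
      (pointSingularity d ‖x - v.y j‖ : ℂ) else 0) =
      greenSingularCoeff d * q j * (pointSingularity d ‖x - v.y j‖ : ℂ) := by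
    simp only [mul_ite, mul_zero, Finset.sum_ite_eq', Finset.mem_univ, if_true]
    ring
  simp only [mul_sub, mul_add, Finset.sum_sub_distrib, Finset.sum_add_distrib, h3, wave]
  simp only [mul_comm (q _) (v.greenMatrix _ _ _)]
  ring

/-- The point condition at a scatterer is a linear equation for the amplitudes. -/
theorem pointCondition_wave_iff (hd : d = 2 ∨ d = 3) (v : MultipointScatterer d n)
    {k : EuclideanSpace ℝ (Fin d)} (hk : 0 < ‖k‖) (q : Fin n → ℂ) (j : Fin n) :
    PointCondition (v.α j) (v.y j) (v.wave k q) ↔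
      (v.α j = OnePoint.infty → q j = 0) ∧
      ∀ a : ℝ, v.α j = (a : OnePoint ℝ) →
        (pointRatio d a * greenSingularCoeff d : ℝ) * q j =
          Complex.exp (Complex.I * ((inner ℝ k (v.y j) : ℝ) : ℂ)) +
            ∑ m, v.greenMatrix ‖k‖ j m * q m := by
  have : Nontrivial (EuclideanSpace ℝ (Fin d)) :=
    Module.nontrivial_of_finrank_pos (R := ℝ) (by rw [finrank_euclideanSpace_fin]; omega)
  have hg : (greenSingularCoeff d : ℂ) ≠ 0 := by
    have : greenSingularCoeff d ≠ 0 := by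
      have := Real.pi_pos
      unfold greenSingularCoeff
      split_ifs
      · positivity
      · exact div_ne_zero (by norm_num) (by positivity)
    exact_mod_cast this
  have hexp := v.wave_expansion hd hk q j
  constructor
  · rintro ⟨s, c, h, h_infty, h_fin⟩
    have h1 := (h.sub hexp).congr_left (f₂ := fun x =>
      (greenSingularCoeff d * q j - s) * (pointSingularity d ‖x - v.y j‖ : ℂ) +
      ((Complex.exp (Complex.I * ((inner ℝ k (v.y j) : ℝ) : ℂ)) +
        ∑ m, v.greenMatrix ‖k‖ j m * q m) - c)) fun x => by ring
    obtain ⟨hs, hc⟩ := pointExpansion_coeff_eq_zero _ h1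
    rw [sub_eq_zero] at hs hc
    refine ⟨fun hα => ?_, fun a hα => ?_⟩
    · rw [h_infty hα] at hs
      exact (mul_eq_zero.1 hs).resolve_left hg
    · rw [hc, ← h_fin a hα, ← hs]
      push_cast
      ring
  · rintro ⟨h_infty, h_fin⟩
    refine ⟨_, _, hexp, fun hα => by rw [h_infty hα, mul_zero], fun a hα => ?_⟩
    rw [← h_fin a hα]
    push_cast
    ring

end MultipointScatterer

/-! ### Unique solvability for the amplitudes -/

/-- A complex symmetric matrix whose imaginary part is a negative multiple of a Gram matrix: if the
quadratic form is real at `q`, then the corresponding combination of the Gram vectors vanishes. -/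
theorem sum_smul_eq_zero_of_im_gram {n : ℕ} {H : Type*} [NormedAddCommGroup H]
    [InnerProductSpace ℂ H] {M : Matrix (Fin n) (Fin n) ℂ} (hM : ∀ j m, M j m = M m j)
    {w : ℝ} (hw : 0 < w) (e : Fin n → H)
    (him : ∀ j m, ((M j m).im : ℂ) = -w * inner ℂ (e j) (e m)) (q : Fin n → ℂ)
    (hq : (∑ j, ∑ m, (starRingEnd ℂ) (q j) * q m * M j m).im = 0) :
    ∑ j, q j • e j = 0 := by
  set Q := ∑ j, ∑ m, (starRingEnd ℂ) (q j) * q m * M j m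
  have h1 : (starRingEnd ℂ) Q =
      ∑ j, ∑ m, (starRingEnd ℂ) (q j) * q m * (starRingEnd ℂ) (M j m) := by
    simp only [Q, map_sum, map_mul, Complex.conj_conj]
    rw [Finset.sum_comm]
    refine Finset.sum_congr rfl fun j _ => Finset.sum_congr rfl fun m _ => ?_
    rw [hM m j]
    ring
  have h2 : Q - (starRingEnd ℂ) Q = -2 * Complex.I * w *
      inner ℂ (∑ j, q j • e j) (∑ j, q j • e j) := by
    rw [h1]
    simp only [Q, ← Finset.sum_sub_distrib, ← mul_sub, Complex.sub_conj, sum_inner, inner_sum,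
      inner_smul_left, inner_smul_right, Finset.mul_sum]
    rw [Finset.sum_comm]
    refine Finset.sum_congr rfl fun m _ => Finset.sum_congr rfl fun j _ => ?_
    push_cast
    rw [him]
    ring
  rw [Complex.sub_conj, hq] at h2
  have h3 : (-2 * Complex.I * w : ℂ) ≠ 0 := by
    simp [hw.ne']
  have h4 := (mul_eq_zero.1 (h2.symm.trans (by simp))).resolve_left h3
  exact inner_self_eq_zero.1 h4

namespace MultipointScatterer

variable {d n : ℕ}

open Classical in
/-- The matrix of the linear system for the amplitudes: the identity in the rows with `α = ∞`, and
the Bethe–Peierls equations in the other rows. -/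
def systemMatrix (v : MultipointScatterer d n) (κ : ℝ) : Matrix (Fin n) (Fin n) ℂ :=
  .of fun j m => if v.α j = OnePoint.infty then (if j = m then 1 else 0) else
    (if j = m then
      (((v.α j).elim 0 (fun a => pointRatio d a * greenSingularCoeff d) : ℝ) : ℂ) else 0) -
      v.greenMatrix κ j m

theorem systemMatrix_mulVec_of_eq_infty (v : MultipointScatterer d n) (κ : ℝ) (q : Fin n → ℂ)
    {j : Fin n} (h : v.α j = OnePoint.infty) : (v.systemMatrix κ).mulVec q j = q j := by
  simp [Matrix.mulVec, dotProduct, systemMatrix, h]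

theorem systemMatrix_mulVec_of_eq_coe (v : MultipointScatterer d n) (κ : ℝ) (q : Fin n → ℂ)
    {j : Fin n} {a : ℝ} (h : v.α j = (a : OnePoint ℝ)) :
    (v.systemMatrix κ).mulVec q j =
      (pointRatio d a * greenSingularCoeff d : ℝ) * q j - ∑ m, v.greenMatrix κ j m * q m := by
  simp [Matrix.mulVec, dotProduct, systemMatrix, h, sub_mul, Finset.sum_sub_distrib]

open Classical in
theorem isScatteringVector_iff (hd : d = 2 ∨ d = 3) (v : MultipointScatterer d n)
    {k : EuclideanSpace ℝ (Fin d)} (hk : 0 < ‖k‖) (q : Fin n → ℂ) :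
    v.IsScatteringVector k q ↔ (v.systemMatrix ‖k‖).mulVec q =
      fun j => if v.α j = OnePoint.infty then 0 else
        Complex.exp (Complex.I * ((inner ℝ k (v.y j) : ℝ) : ℂ)) := by
  rw [funext_iff]
  refine forall_congr' fun j => ?_
  rw [v.pointCondition_wave_iff hd hk]
  by_cases h : v.α j = OnePoint.infty
  · rw [v.systemMatrix_mulVec_of_eq_infty _ q h]
    simp [h]
  · obtain ⟨a, ha⟩ := OnePoint.ne_infty_iff_exists.1 h
    rw [v.systemMatrix_mulVec_of_eq_coe _ q ha.symm, sub_eq_iff_eq_add]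
    simp [← ha, eq_comm]

/-- The linear system for the amplitudes is uniquely solvable: the quadratic form of a solution of
the homogeneous system is real, so the corresponding combination of plane waves vanishes on the
sphere. -/
theorem isUnit_systemMatrix (hd : d = 2 ∨ d = 3) (v : MultipointScatterer d n)
    {κ : ℝ} (hκ : 0 < κ) : IsUnit (v.systemMatrix κ) := by
  rw [← Matrix.mulVec_injective_iff_isUnit]
  refine (injective_iff_map_eq_zero (v.systemMatrix κ).mulVecLin).2 fun q hq => ?_
  have hrow : ∀ j, (v.systemMatrix κ).mulVec q j = 0 := congrFun hq
  obtain ⟨w, hw, him⟩ := exists_im_green_eq_inner hd hκ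
  have hsum : ∑ j, q j • planeWaveLp (κ • v.y j) = 0 := by
    refine sum_smul_eq_zero_of_im_gram (M := v.greenMatrix κ) (v.greenMatrix_comm κ) hw
      (fun j => planeWaveLp (κ • v.y j)) (fun j m => him (v.y j) (v.y m)) q ?_
    rw [Complex.im_sum]
    refine Finset.sum_eq_zero fun j _ => ?_
    simp only [mul_assoc, ← Finset.mul_sum, mul_comm (q _)]
    by_cases h : v.α j = OnePoint.infty
    · have h0 := hrow j
      rw [v.systemMatrix_mulVec_of_eq_infty κ q h] at h0
      simp [h0]
    · obtain ⟨a, ha⟩ := OnePoint.ne_infty_iff_exists.1 h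
      have h0 := hrow j
      rw [v.systemMatrix_mulVec_of_eq_coe κ q ha.symm, sub_eq_zero] at h0
      rw [← h0, mul_left_comm, ← Complex.normSq_eq_conj_mul_self, ← Complex.ofReal_mul,
        Complex.ofReal_im]
  have hinj : Function.Injective fun j => κ • v.y j :=
    (smul_right_injective _ hκ.ne').comp v.y_injective
  have hli := (linearIndependent_planeWaveLp (d := d) (by omega)).comp _ hinj
  exact funext (Fintype.linearIndependent_iff.1 hli q hsum)

/-- The amplitudes of the scattering eigenfunction are unique and depend linearly on the values of
the incoming plane wave at the scatterers. -/
theorem exists_isScatteringVector_iff (hd : d = 2 ∨ d = 3) (v : MultipointScatterer d n)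
    {κ : ℝ} (hκ : 0 < κ) : ∃ C : Matrix (Fin n) (Fin n) ℂ,
      ∀ (k : EuclideanSpace ℝ (Fin d)) (q : Fin n → ℂ), ‖k‖ = κ →
        (v.IsScatteringVector k q ↔
          q = C.mulVec fun m => Complex.exp (Complex.I * ((inner ℝ k (v.y m) : ℝ) : ℂ))) := by
  classical
  have hdet := (Matrix.isUnit_iff_isUnit_det _).1 (v.isUnit_systemMatrix hd hκ)
  refine ⟨(v.systemMatrix κ)⁻¹ * Matrix.diagonal fun j => if v.α j = OnePoint.infty then 0 else 1,
    fun k q hk => ?_⟩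
  rw [v.isScatteringVector_iff hd (hk ▸ hκ), hk, ← Matrix.mulVec_mulVec]
  have hb : (Matrix.diagonal fun j => if v.α j = OnePoint.infty then (0 : ℂ) else 1).mulVec
      (fun m => Complex.exp (Complex.I * ((inner ℝ k (v.y m) : ℝ) : ℂ))) =
      fun j => if v.α j = OnePoint.infty then 0 else
        Complex.exp (Complex.I * ((inner ℝ k (v.y j) : ℝ) : ℂ)) := by
    ext j
    simp [Matrix.mulVec_diagonal]
  rw [hb]
  constructor
  · intro h
    rw [← h, Matrix.mulVec_mulVec, Matrix.nonsing_inv_mul _ hdet, Matrix.one_mulVec]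
  · rintro rfl
    rw [Matrix.mulVec_mulVec, Matrix.mul_nonsing_inv _ hdet, Matrix.one_mulVec]

end MultipointScatterer

/-! ### The scattering operator -/

theorem conj_planeWave_eq {d : ℕ} (z : EuclideanSpace ℝ (Fin d)) (θ : UnitSphere d) :
    (starRingEnd ℂ) (planeWave z θ) = planeWave (-z) θ := by
  rw [conj_planeWave, planeWave_apply]
  simp

theorem coeFn_planeWaveLp {d : ℕ} (z : EuclideanSpace ℝ (Fin d)) :
    (planeWaveLp z : UnitSphere d → ℂ) =ᵐ[sphereMeasure d] planeWave z :=
  ContinuousMap.coeFn_toLp _ _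

theorem integrable_planeWave_mul {d : ℕ} (z : EuclideanSpace ℝ (Fin d))
    (u : Lp ℂ 2 (sphereMeasure d)) :
    Integrable (fun θ => planeWave z θ * u θ) (sphereMeasure d) := by
  refine (L2.integrable_inner (𝕜 := ℂ) (planeWaveLp (-z)) u).congr ?_
  filter_upwards [coeFn_planeWaveLp (-z)] with θ hθ
  rw [RCLike.inner_apply, hθ, conj_planeWave_eq, neg_neg, mul_comm]

theorem integral_planeWave_mul {d : ℕ} (z : EuclideanSpace ℝ (Fin d))
    (u : Lp ℂ 2 (sphereMeasure d)) :
    ∫ θ, planeWave z θ * u θ ∂sphereMeasure d = inner ℂ (planeWaveLp (-z)) u := by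
  rw [L2.inner_def]
  refine integral_congr_ae ?_
  filter_upwards [coeFn_planeWaveLp (-z)] with θ hθ
  rw [RCLike.inner_apply, hθ, conj_planeWave_eq, neg_neg, mul_comm]

/-- A finite-rank perturbation of the identity of an infinite-dimensional space has an
infinite-dimensional space of fixed vectors. -/
theorem not_finiteDimensional_eigenspace_one {V : Type*} [AddCommGroup V] [Module ℂ V]
    (hV : ¬ FiniteDimensional ℂ V) (S : V →ₗ[ℂ] V) (W : Submodule ℂ V) [FiniteDimensional ℂ W]
    (hS : ∀ u, S u - u ∈ W) : ¬ FiniteDimensional ℂ (Module.End.eigenspace S 1) := by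
  intro h
  have hker : Module.End.eigenspace S 1 = LinearMap.ker (S - LinearMap.id) := by
    ext u
    simp [sub_eq_zero]
  rw [hker] at h
  have hrange : LinearMap.range (S - LinearMap.id) ≤ W := by
    rintro _ ⟨u, rfl⟩
    exact hS u
  have := Submodule.finiteDimensional_of_le hrange
  have : FiniteDimensional ℂ (V ⧸ LinearMap.ker (S - LinearMap.id)) :=
    (S - LinearMap.id).quotKerEquivRange.symm.finiteDimensional
  exact hV (Module.Finite.of_submodule_quotient (LinearMap.ker (S - LinearMap.id)))

namespace MultipointScatterer

variable {d n : ℕ}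

/-- The identity minus `c` times the finite-rank integral operator with the kernel
`(θ', θ) ↦ ∑ j m, C j m e^{iκθ'·yₘ} e^{-iκθ·yⱼ}`. Integration against `e^{iκθ'·yₘ}` is the inner
product with the wave `e^{-iκθ'·yₘ}`, as the inner product is conjugate-linear on the left. -/
def finiteRankPerturbation (v : MultipointScatterer d n) (κ : ℝ) (c : ℂ)
    (C : Matrix (Fin n) (Fin n) ℂ) :
    Lp ℂ 2 (sphereMeasure d) →L[ℂ] Lp ℂ 2 (sphereMeasure d) :=
  ContinuousLinearMap.id ℂ _ - c • ∑ j, ∑ m, C j m •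
    (innerSL ℂ (planeWaveLp (-(κ • v.y m)))).smulRight (planeWaveLp (-(κ • v.y j)))

theorem finiteRankPerturbation_apply (v : MultipointScatterer d n) (κ : ℝ) (c : ℂ)
    (C : Matrix (Fin n) (Fin n) ℂ) (u : Lp ℂ 2 (sphereMeasure d)) :
    v.finiteRankPerturbation κ c C u = u - c • ∑ j,
      (∑ m, C j m * inner ℂ (planeWaveLp (-(κ • v.y m))) u) • planeWaveLp (-(κ • v.y j)) := by
  simp [finiteRankPerturbation, Finset.sum_smul, smul_smul]

theorem coeFn_finiteRankPerturbation (v : MultipointScatterer d n) (κ : ℝ) (c : ℂ)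
    (C : Matrix (Fin n) (Fin n) ℂ) (u : Lp ℂ 2 (sphereMeasure d)) :
    ∀ᵐ θ ∂sphereMeasure d, v.finiteRankPerturbation κ c C u θ = u θ - c * ∑ j,
      (∑ m, C j m * inner ℂ (planeWaveLp (-(κ • v.y m))) u) * planeWave (-(κ • v.y j)) θ := by
  rw [finiteRankPerturbation_apply]
  filter_upwards [Lp.coeFn_sub u (c • ∑ j,
      (∑ m, C j m * inner ℂ (planeWaveLp (-(κ • v.y m))) u) • planeWaveLp (-(κ • v.y j))),
    Lp.coeFn_smul c (∑ j,
      (∑ m, C j m * inner ℂ (planeWaveLp (-(κ • v.y m))) u) • planeWaveLp (-(κ • v.y j))),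
    Lp.coeFn_fun_finsetSum Finset.univ (fun j =>
      (∑ m, C j m * inner ℂ (planeWaveLp (-(κ • v.y m))) u) • planeWaveLp (-(κ • v.y j))),
    ae_all_iff.2 fun j => Lp.coeFn_smul
      (∑ m, C j m * inner ℂ (planeWaveLp (-(κ • v.y m))) u) (planeWaveLp (-(κ • v.y j))),
    ae_all_iff.2 fun j => coeFn_planeWaveLp (-(κ • v.y j))] with θ h1 h2 h3 h4 h5
  rw [h1, Pi.sub_apply, h2, Pi.smul_apply, h3, smul_eq_mul]
  congr 2
  refine Finset.sum_congr rfl fun j _ => ?_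
  rw [h4 j, Pi.smul_apply, h5 j, smul_eq_mul]

/-- The scattering operator exists, is unique, and differs from the identity by an explicit
operator of finite rank. -/
theorem exists_isScatteringOperator_iff (hd : d = 2 ∨ d = 3) (v : MultipointScatterer d n)
    {E : ℝ} (hE : 0 < E) : ∃ (c : ℂ) (C : Matrix (Fin n) (Fin n) ℂ),
      ∀ S, v.IsScatteringOperator E S ↔ S = v.finiteRankPerturbation (√E) c C := by
  have hκ : 0 < √E := Real.sqrt_pos.2 hE
  obtain ⟨C, hC⟩ := v.exists_isScatteringVector_iff hd hκ
  have hnorm : ∀ k : EuclideanSpace ℝ (Fin d), ‖k‖ ^ 2 = E → ‖k‖ = √E := fun k hk => by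
    rw [← hk, Real.sqrt_sq (norm_nonneg _)]
  have hsphere : ∀ θ : UnitSphere d, ‖√E • (θ : EuclideanSpace ℝ (Fin d))‖ ^ 2 = E := fun θ => by
    rw [norm_smul, norm_eq_of_mem_sphere, mul_one, Real.norm_of_nonneg hκ.le, Real.sq_sqrt hE.le]
  set a : ℂ := 1 / (2 * (Real.pi : ℂ)) ^ d
  refine ⟨Complex.I * (Real.pi : ℂ) * ((√E : ℝ) : ℂ) ^ (d - 2) * a, C, fun S => ?_⟩
  -- The amplitude is determined on the energy shell, where it is a sum of products of plane waves.
  have hkernel : ∀ f, v.IsScatteringAmplitude E f → ∀ θ' θ : UnitSphere d,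
      f (√E • (θ' : EuclideanSpace ℝ (Fin d))) (√E • (θ : EuclideanSpace ℝ (Fin d))) =
        ∑ j, ∑ m, a * C j m * planeWave (-(√E • v.y j)) θ * planeWave (√E • v.y m) θ' := by
    intro f hf θ' θ
    obtain ⟨q, hq, hfq⟩ := hf _ (hsphere θ')
    rw [hfq _ (hsphere θ), (hC _ q (hnorm _ (hsphere θ'))).1 hq, Finset.mul_sum]
    refine Finset.sum_congr rfl fun j _ => ?_
    simp only [Matrix.mulVec, dotProduct, Finset.sum_mul, Finset.mul_sum]
    refine Finset.sum_congr rfl fun m _ => ?_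
    simp only [planeWave_apply, real_inner_smul_left, real_inner_smul_right, inner_neg_right,
      Complex.ofReal_neg, mul_neg]
    ring
  have hint : ∀ f, v.IsScatteringAmplitude E f → ∀ (u : Lp ℂ 2 (sphereMeasure d))
      (θ : UnitSphere d), Integrable (fun θ' : UnitSphere d =>
        f (√E • (θ' : EuclideanSpace ℝ (Fin d))) (√E • (θ : EuclideanSpace ℝ (Fin d))) * u θ')
        (sphereMeasure d) ∧
      ∫ θ' : UnitSphere d, f (√E • (θ' : EuclideanSpace ℝ (Fin d)))
        (√E • (θ : EuclideanSpace ℝ (Fin d))) * u θ' ∂(sphereMeasure d) =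
        a * ∑ j, (∑ m, C j m * inner ℂ (planeWaveLp (-(√E • v.y m))) u) *
          planeWave (-(√E • v.y j)) θ := by
    intro f hf u θ
    have hi : ∀ j m, Integrable (fun θ' : UnitSphere d =>
        a * C j m * planeWave (-(√E • v.y j)) θ * (planeWave (√E • v.y m) θ' * u θ'))
        (sphereMeasure d) := fun j m => (integrable_planeWave_mul _ u).const_mul _
    simp only [hkernel f hf, Finset.sum_mul, mul_assoc (_ * _) (planeWave (√E • v.y _) _) (u _)]
    refine ⟨integrable_finsetSum _ fun j _ => integrable_finsetSum _ fun m _ => hi j m, ?_⟩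
    rw [integral_finsetSum _ fun j _ => integrable_finsetSum _ fun m _ => hi j m, Finset.mul_sum]
    refine Finset.sum_congr rfl fun j _ => ?_
    rw [integral_finsetSum _ fun m _ => hi j m, Finset.mul_sum]
    refine Finset.sum_congr rfl fun m _ => ?_
    rw [integral_const_mul, integral_planeWave_mul]
    ring
  constructor
  · rintro ⟨f, hf, hS⟩
    refine ContinuousLinearMap.ext fun u => Lp.ext ?_
    filter_upwards [(hS u).2, v.coeFn_finiteRankPerturbation (√E) _ C u] with θ h1 h2
    rw [h1, h2, (hint f hf u θ).2]
    ring
  · rintro rfl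
    let f : EuclideanSpace ℝ (Fin d) → EuclideanSpace ℝ (Fin d) → ℂ := fun k l =>
      a * ∑ j, C.mulVec (fun m => Complex.exp (Complex.I * ((inner ℝ k (v.y m) : ℝ) : ℂ))) j *
        Complex.exp (-(Complex.I * ((inner ℝ l (v.y j) : ℝ) : ℂ)))
    have hf : v.IsScatteringAmplitude E f := fun k hk =>
      ⟨_, (hC k _ (hnorm k hk)).2 rfl, fun l _ => rfl⟩
    refine ⟨f, hf, fun u => ⟨fun θ => (hint f hf u θ).1, ?_⟩⟩
    filter_upwards [v.coeFn_finiteRankPerturbation (√E) _ C u] with θ h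
    rw [h, (hint f hf u θ).2]
    ring

end MultipointScatterer

end

theorem theorem1 (d n : ℕ) (hd : d = 2 ∨ d = 3) (v : MultipointScatterer d n)
    (E : ℝ) (hE : 0 < E) :
    (∃! S, v.IsScatteringOperator E S) ∧
    ∀ S, v.IsScatteringOperator E S →
      Module.End.HasEigenvalue
        (S : Lp ℂ 2 (sphereMeasure d) →ₗ[ℂ] Lp ℂ 2 (sphereMeasure d)) 1 ∧
      ¬ FiniteDimensional ℂ (Module.End.eigenspace
        (S : Lp ℂ 2 (sphereMeasure d) →ₗ[ℂ] Lp ℂ 2 (sphereMeasure d)) 1) := by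
  obtain ⟨c, C, hS⟩ := v.exists_isScatteringOperator_iff hd hE
  refine ⟨⟨_, (hS _).2 rfl, fun S h => (hS S).1 h⟩, fun S h => ?_⟩
  obtain rfl := (hS S).1 h
  have := FiniteDimensional.span_of_finite ℂ
    (Set.finite_range fun j => (planeWaveLp (-(√E • v.y j)) : Lp ℂ 2 (sphereMeasure d)))
  have := FiniteDimensional.span_of_finite ℂ
    (Set.finite_range fun j => (planeWaveLp (-(√E • v.y j)) : Lp ℂ 2 (sphereMeasure d)))
  have hinf := not_finiteDimensional_eigenspace_one
    (not_finiteDimensional_Lp_sphere (d := d) (by omega))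
    (v.finiteRankPerturbation (√E) c C : Lp ℂ 2 (sphereMeasure d) →ₗ[ℂ] Lp ℂ 2 (sphereMeasure d))
    (Submodule.span ℂ (Set.range fun j => planeWaveLp (-(√E • v.y j)))) fun u => by
      rw [ContinuousLinearMap.coe_coe, v.finiteRankPerturbation_apply, sub_sub_cancel_left]
      exact neg_mem (Submodule.smul_mem _ _ (Submodule.sum_mem _ fun j _ =>
        Submodule.smul_mem _ _ (Submodule.subset_span ⟨j, rfl⟩)))
  refine ⟨fun hbot => hinf ?_, hinf⟩
  rw [Module.End.eigenspace, hbot]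
  infer_instance
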